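/- Let $(W,S)$ be a Coxeter system with $S$ finite, with length function $\ell$. Let $V$ be the real vector space with basis $\{\alpha_s \mid s\in S\}$ and symmetric bilinear form $\langle\alpha_s,\alpha_t\rangle=-\cos(\pi/m(s,t))$ (equal to $-1$ if $m(s,t)=\infty$), let $W$ act on $V$ by $s v=v-2\langle v,\alpha_s\rangle\alpha_s$, and let $\Phi=\{w\alpha_s \mid w\in W, s\in S\}$ be the root system, with positive roots $\Phi^+$. For $w\in W$ put $$\Phi(w)=\{\alpha\in\Phi^+\mid w^{-1}\alpha<0\},\quad \Phi^R(w)=\{-w\alpha_s\mid s\in S,\ \ell(ws)<\ell(w)\},\quad T(w)=\{v\in W\mid \ell(wv)=\ell(w)+\ell(v)\}.$$ The sets $T(w)$ are the cone types. For a cone type $T$ let $Q(T)=\{x\in W\mid T(x^{-1})=T\}$ and let $$\partial T=\{\beta\in\Phi^+\mid \Phi(w)\cap\Phi(y)=\{\beta\}\text{ for some } w\in Q(T) \text{ and some } y\in W\}$$ be its set of boundary roots. Let $\Gamma$ be the set of the elements $m_T^{-1}$, where $T$ is a cone type and $m_T$ is the unique element of minimal length with $T(m_T)=T$, and let $\Gamma^0=\{g\in\Gamma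 \mid |\Phi^R(g)|=1\}$. For $x\in W$ and $\beta \in \Phi^+$ put $$\partial T(x^{-1})_\beta=\{y\in W\mid \Phi(x)\cap\Phi(y)=\{\beta\}\},\qquad \partial T_\beta=\{y\in W\mid \Phi(x)\cap\Phi(y)=\{\beta\}\text{ for all }x\in Q(T)\}.$$ Write $x\preceq y$ if $\ell(y)=\ell(x)+\ell(x^{-1}y)$. An element $g$ of a set $X\subseteq W$ is the gate of $X$ if it is the unique element of minimal length of $X$ and $g\preceq y$ for all $y\in X$; $X$ is gated if it has a gate. $X$ is convex if for all $x,y\in X$ and every reduced expression $x^{-1}y=s_1\cdots s_n$ all the elements $xs_1\cdots s_j$ with $0\le j\le n$ lie in $X$. **Corollary 1.5.** Let $T$ be a cone type and let $\beta\in\partial T$. Among all $y\in W$ such that $\Phi(x)\cap\Phi(y)=\{\beta\}$ for all $x\in Q(T)$ there is a unique one of minimal length. This element $y$ lies in $\Gamma^0$, and it is the gate of $\partial T(x^{-1})_\beta$ for every $x\in Q(T)$ and the gate of $\partial T_\beta$. Moreover, $\partial T_\beta$ is nonempty, $\partial T_\beta=\bigcap_{x\in Q(T)}\partial T(x^{-1})_\beta$,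 and $\partial T_\beta$ is convex and gated. -/

import Mathlib

noncomputable section

namespace CoxeterMatrix

variable {B : Type*} (M : CoxeterMatrix B)

/-- The symmetric bilinear form on the real vector space with basis `(α_s)`, given by
`⟨α_s, α_t⟩ = -cos (π / m(s,t))`. An infinite label is encoded as `M s t = 0`, and then
the value is `-cos 0 = -1`, the usual convention. -/
def form : (B →₀ ℝ) →ₗ[ℝ] (B →₀ ℝ) →ₗ[ℝ] ℝ :=
  Finsupp.linearCombination ℝ fun s =>
    Finsupp.linearCombination ℝ fun t => -Real.cos (Real.pi / M s t)

/-- The simple root `α_s`. -/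
def simpleRoot (_M : CoxeterMatrix B) (s : B) : B →₀ ℝ := Finsupp.single s 1

/-- The linear form `v ↦ 2 ⟨v, α_s⟩`. -/
def simpleCoroot (s : B) : Module.Dual ℝ (B →₀ ℝ) := (2 : ℝ) • M.form.flip (M.simpleRoot s)

lemma simpleCoroot_apply (s : B) (v : B →₀ ℝ) :
    M.simpleCoroot s v = 2 * M.form v (M.simpleRoot s) := rfl

lemma form_simpleRoot (s t : B) :
    M.form (M.simpleRoot s) (M.simpleRoot t) = -Real.cos (Real.pi / M s t) := by
  simp [form, simpleRoot]

lemma simpleCoroot_simpleRoot (s : B) : M.simpleCoroot s (M.simpleRoot s) = 2 := by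
  rw [simpleCoroot_apply, form_simpleRoot]; simp

/-- The simple reflection `v ↦ v - 2 ⟨v, α_s⟩ α_s`. -/
def simpleReflection (s : B) : (B →₀ ℝ) ≃ₗ[ℝ] (B →₀ ℝ) :=
  Module.reflection (M.simpleCoroot_simpleRoot s)

lemma simpleReflection_apply (s : B) (v : B →₀ ℝ) :
    M.simpleReflection s v = v - (2 * M.form v (M.simpleRoot s)) • M.simpleRoot s := by
  rw [simpleReflection, Module.reflection_apply, simpleCoroot_apply]

open Polynomial.Chebyshev in
lemma isLiftable_simpleReflection : M.IsLiftable M.simpleReflection := by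
  intro s t
  by_cases hst : s = t
  · subst hst
    have : M.simpleReflection s * M.simpleReflection s = 1 := by
      ext1 v
      exact Module.involutive_reflection (M.simpleCoroot_simpleRoot s) v
    simp [this]
  have hm1 : M s t ≠ 1 := M.off_diagonal s t hst
  by_cases hm0 : M s t = 0
  · simp [hm0]
  have hf : M.simpleCoroot s (M.simpleRoot t) = -2 * Real.cos (Real.pi / M s t) := by
    rw [simpleCoroot_apply, form_simpleRoot, M.symmetric t s]; ring
  have hg : M.simpleCoroot t (M.simpleRoot s) = -2 * Real.cos (Real.pi / M s t) := by
    rw [simpleCoroot_apply, form_simpleRoot]; ring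
  generalize hm : M s t = m at *
  by_cases hm2 : m = 2
  · subst hm2
    have hf0 : M.simpleCoroot s (M.simpleRoot t) = 0 := by rw [hf]; simp
    have hg0 : M.simpleCoroot t (M.simpleRoot s) = 0 := by rw [hg]; simp
    ext1 v
    simp only [simpleReflection, pow_two, LinearEquiv.mul_apply, Module.reflection_apply,
      map_sub, map_smul, hf0, hg0, simpleCoroot_simpleRoot, LinearEquiv.coe_one, id]
    module
  have hm3 : 3 ≤ m := by omega
  have hmR : (0 : ℝ) < m := by positivity
  have hm3R : (3 : ℝ) ≤ m := by exact_mod_cast hm3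
  set θ : ℝ := 2 * Real.pi / m with hθ
  have hsin : Real.sin θ ≠ 0 := by
    apply ne_of_gt
    apply Real.sin_pos_of_pos_of_lt_pi
    · positivity
    · rw [hθ, div_lt_iff₀ hmR]
      nlinarith [Real.pi_pos]
  have ht : 2 * Real.cos θ = M.simpleCoroot s (M.simpleRoot t) *
      M.simpleCoroot t (M.simpleRoot s) - 2 := by
    rw [hf, hg, show θ = 2 * (Real.pi / m) by rw [hθ]; ring, Real.cos_two_mul]; ring
  have hS (k : ℤ) : (S ℝ k).eval (2 * Real.cos θ) * Real.sin θ = Real.sin ((k + 1) * θ) := by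
    rw [← U_real_cos, ← S_comp_two_mul_X]
    simp [Polynomial.eval_comp]
  ext1 v
  rw [simpleReflection, simpleReflection,
    Module.reflection_mul_reflection_pow_apply _ _ m v _ ht]
  rcases Nat.even_or_odd' m with ⟨k, hk | hk⟩
  · have h0 : (S ℝ ((k : ℤ) - 1)).eval (2 * Real.cos θ) = 0 := by
      have h := hS (k - 1)
      have h2 : ((((k : ℤ) - 1 : ℤ) : ℝ) + 1) * θ = Real.pi := by
        rw [hθ, hk]
        have : (k : ℝ) ≠ 0 := by
          intro h; have : k = 0 := by exact_mod_cast h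
          omega
        push_cast
        field_simp
        ring
      rw [h2, Real.sin_pi] at h
      exact (mul_eq_zero.mp h).resolve_right hsin
    have e1 : ((m : ℤ) - 2) / 2 = k - 1 := by omega
    have e2 : ((m : ℤ) - 1) / 2 = k - 1 := by omega
    rw [e1, e2, h0]
    simp
  · have h0 : (S ℝ (k : ℤ)).eval (2 * Real.cos θ) +
        (S ℝ ((k : ℤ) - 1)).eval (2 * Real.cos θ) = 0 := by
      have h := hS k
      have h' := hS (k - 1)
      have h2 : Real.sin (((k : ℤ) + 1) * θ) = - Real.sin ((((k : ℤ) - 1 : ℤ) + 1) * θ) := by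
        rw [← Real.sin_two_pi_sub]
        congr 1
        rw [hθ, hk]
        have : (2 * (k : ℝ) + 1) ≠ 0 := by positivity
        push_cast
        field_simp
        ring
      have h3 := mul_eq_zero.mp (show ((S ℝ (k : ℤ)).eval (2 * Real.cos θ) +
        (S ℝ ((k : ℤ) - 1)).eval (2 * Real.cos θ)) * Real.sin θ = 0 by
          rw [add_mul, h, h', h2]; ring)
      exact h3.resolve_right hsin
    have e1 : ((m : ℤ) - 2) / 2 = k - 1 := by omega
    have e2 : ((m : ℤ) - 1) / 2 = k := by omega
    have e3 : ((m : ℤ) - 3) / 2 = k - 1 := by omega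
    have e4 : (m : ℤ) / 2 = k := by omega
    rw [e1, e2, e3, e4, h0]
    simp

end CoxeterMatrix

namespace CoxeterSystem

variable {B W : Type*} [Group W] {M : CoxeterMatrix B} (cs : CoxeterSystem M W)

/-- The action of `W` on the real vector space with basis `(α_s)`. -/
def geomRep : W →* ((B →₀ ℝ) ≃ₗ[ℝ] (B →₀ ℝ)) :=
  cs.lift ⟨M.simpleReflection, M.isLiftable_simpleReflection⟩

lemma geomRep_simple (s : B) : cs.geomRep (cs.simple s) = M.simpleReflection s :=
  cs.lift_apply_simple M.isLiftable_simpleReflection s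

/-- The root system `Φ = {w α_s}`. -/
def roots : Set (B →₀ ℝ) := {α | ∃ (w : W) (s : B), α = cs.geomRep w (M.simpleRoot s)}

/-- The positive roots `Φ⁺`. -/
def posRoots : Set (B →₀ ℝ) := {α | α ∈ cs.roots ∧ ∀ s, 0 ≤ α s}

/-- The negative roots `Φ⁻`. -/
def negRoots : Set (B →₀ ℝ) := {α | α ∈ cs.roots ∧ ∀ s, α s ≤ 0}

/-- The (left) inversion set `Φ(w) = {α ∈ Φ⁺ | w⁻¹ α < 0}`. -/
def inversionSet (w : W) : Set (B →₀ ℝ) :=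
  {α | α ∈ cs.posRoots ∧ cs.geomRep w⁻¹ α ∈ cs.negRoots}

/-- The right-descent roots `Φᴿ(w) = {-w α_s | s ∈ D_R(w)}`. -/
def rightDescentRoots (w : W) : Set (B →₀ ℝ) :=
  {α | ∃ s : B, cs.IsRightDescent w s ∧ α = -cs.geomRep w (M.simpleRoot s)}

/-- The right weak order: `x ≼ y` if and only if `ℓ(y) = ℓ(x) + ℓ(x⁻¹ y)`. -/
def RightWeakLE (x y : W) : Prop := cs.length y = cs.length x + cs.length (x⁻¹ * y)

/-- `x` is the unique element of minimal length of `X`. -/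
def IsUniqueShortest (X : Set W) (x : W) : Prop :=
  x ∈ X ∧ ∀ y ∈ X, y ≠ x → cs.length x < cs.length y

/-- `x` is the gate of `X`: the unique element of minimal length of `X`, and a prefix of every
element of `X`. -/
def IsGate (X : Set W) (x : W) : Prop :=
  cs.IsUniqueShortest X x ∧ ∀ y ∈ X, cs.RightWeakLE x y

/-- A set is gated if it has a gate. -/
def IsGated (X : Set W) : Prop := ∃ x, cs.IsGate X x

/-- `X` is convex: for `x, y ∈ X` and every reduced expression `x⁻¹ y = s₁ ⋯ sₙ`, all the elements
`x s₁ ⋯ s_j` with `0 ≤ j ≤ n` lie in `X`. -/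
def IsConvex (X : Set W) : Prop :=
  ∀ x ∈ X, ∀ y ∈ X, ∀ ω : List B, cs.IsReduced ω → cs.wordProd ω = x⁻¹ * y →
    ∀ j ≤ ω.length, x * cs.wordProd (ω.take j) ∈ X

/-- The cone type `T(w) = {v | ℓ(w v) = ℓ(w) + ℓ(v)}`. -/
def coneType (w : W) : Set W := {v | cs.length (w * v) = cs.length w + cs.length v}

/-- The set of all cone types. -/
def coneTypes : Set (Set W) := Set.range cs.coneType

/-- The cone type part `Q(T) = {x | T(x⁻¹) = T}`. -/
def coneTypePart (T : Set W) : Set W := {x | cs.coneType x⁻¹ = T}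

/-- The boundary roots `∂T`: the positive roots `β` with `Φ(w) ∩ Φ(y) = {β}` for some `w ∈ Q(T)`
and some `y ∈ W`. -/
def boundaryRoots (T : Set W) : Set (B →₀ ℝ) :=
  {β | β ∈ cs.posRoots ∧
    ∃ y : W, ∃ w ∈ cs.coneTypePart T, cs.inversionSet w ∩ cs.inversionSet y = {β}}

/-- The gates `Γ = {m_T⁻¹ | T a cone type}` of the cone type partition, where `m_T` is the unique
element of minimal length with cone type `T`. -/
def gates : Set W :=
  {g | ∃ T ∈ cs.coneTypes, cs.IsUniqueShortest {w | cs.coneType w = T} g⁻¹}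

/-- The tight gates `Γ⁰ = {g ∈ Γ | |Φᴿ(g)| = 1}`. -/
def tightGates : Set W := {g | g ∈ cs.gates ∧ (cs.rightDescentRoots g).ncard = 1}

/-- The set `∂T(x⁻¹)_β` of witnesses of `β` with respect to the element `x`. -/
def witnesses (x : W) (β : B →₀ ℝ) : Set W :=
  {y | cs.inversionSet x ∩ cs.inversionSet y = {β}}

/-- The set `∂T_β` of witnesses of `β` with respect to the cone type `T`. -/
def coneTypeWitnesses (T : Set W) (β : B →₀ ℝ) : Set W :=
  {y | ∀ x ∈ cs.coneTypePart T, cs.inversionSet x ∩ cs.inversionSet y = {β}}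

end CoxeterSystem

end

/-! Since `ℓ(ws) > ℓ(w)` implies `wα_s ≥ 0` (`geomRep_simpleRoot_nonneg`), lengths add in `ab`
exactly when `Φ(a⁻¹)` and `Φ(b)` are disjoint (`length_mul_eq_add_iff`). So `T(x⁻¹)` consists of the
`v` with `Φ(x) ∩ Φ(v) = ∅`.

A nonempty witness set of `x` has a gate (`exists_isGate_witnesses`). The proof strips a left
descent from `x` and uses joins of bounded pairs in the weak order (`exists_join`).

Let `y` be this gate. If `s` is a right descent of `y`, then `β = -yα_s`, since otherwise `ys` would
be a shorter witness. Hence `Φ(ys) = Φ(y) \ {β}`, and `y` is a witness for `x` exactly because `ys ∈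
T(x⁻¹)` and `y ∉ T(x⁻¹)`. This depends only on the cone type, so all `x ∈ Q(T)` share the gate `y`.
The witness relation is symmetric in `x` and `y`; exchanging their roles shows that `y` is a prefix
of every `z` with `T(z⁻¹) = T(y⁻¹)`, so `y ∈ Γ⁰`. Convexity holds because `∂T_β` is an intersection
of half-spaces. -/

namespace CoxeterSystem

variable {B W : Type*} [Group W] {M : CoxeterMatrix B} (cs : CoxeterSystem M W)

/-! ### Positivity of roots -/

lemma geomRep_simple_simpleRoot (s t : B) :
    cs.geomRep (cs.simple s) (M.simpleRoot t) =
      M.simpleRoot t + (2 * Real.cos (Real.pi / M s t)) • M.simpleRoot s := by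
  rw [geomRep_simple, CoxeterMatrix.simpleReflection_apply, CoxeterMatrix.form_simpleRoot,
    M.symmetric t s]
  module

lemma geomRep_simple_simpleRoot_self (s : B) :
    cs.geomRep (cs.simple s) (M.simpleRoot s) = -M.simpleRoot s := by
  rw [geomRep_simple_simpleRoot, M.diagonal]
  simp
  module

lemma geomRep_mul_simple_simpleRoot (w : W) (s : B) :
    cs.geomRep (w * cs.simple s) (M.simpleRoot s) = -cs.geomRep w (M.simpleRoot s) := by
  rw [map_mul, LinearEquiv.mul_apply, geomRep_simple_simpleRoot_self, map_neg]

/-! ### Dihedral coefficients and alternating words -/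

/-- The coefficients `sin (k θ) / sin θ` of the roots of a dihedral root system, as polynomials
in `2 cos θ`. -/
def dihedralCoeff (c : ℝ) : ℕ → ℝ
  | 0 => 0
  | 1 => 1
  | k + 2 => 2 * c * dihedralCoeff c (k + 1) - dihedralCoeff c k

lemma dihedralCoeff_mul_sin (θ : ℝ) (k : ℕ) :
    dihedralCoeff (Real.cos θ) k * Real.sin θ = Real.sin (k * θ) := by
  induction k using Nat.twoStepInduction with
  | zero => simp [dihedralCoeff]
  | one => simp [dihedralCoeff]
  | more k ih₀ ih₁ =>
    rw [dihedralCoeff, sub_mul, mul_assoc, ih₁, ih₀]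
    have h₁ : ((k + 2 : ℕ) : ℝ) * θ = ((k + 1 : ℕ) : ℝ) * θ + θ := by push_cast; ring
    have h₂ : (k : ℝ) * θ = ((k + 1 : ℕ) : ℝ) * θ - θ := by push_cast; ring
    rw [h₁, h₂, Real.sin_add, Real.sin_sub]
    ring

lemma dihedralCoeff_one (k : ℕ) : dihedralCoeff 1 k = k := by
  induction k using Nat.twoStepInduction with
  | zero => simp [dihedralCoeff]
  | one => simp [dihedralCoeff]
  | more k ih₀ ih₁ => rw [dihedralCoeff, ih₁, ih₀]; push_cast; ring

/-- `sin (kπ/m) / sin (π/m)` is nonnegative while `kπ/m ≤ π`. The infinite label `m = 0` gives `π /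
0 = 0`, so the cosine is 1 and the coefficient is `k`. -/
lemma dihedralCoeff_nonneg {m k : ℕ} (hm : m ≠ 1) (hk : m ≠ 0 → k ≤ m) :
    0 ≤ dihedralCoeff (Real.cos (Real.pi / m)) k := by
  rcases Nat.eq_zero_or_pos m with rfl | hm0
  · simp [dihedralCoeff_one]
  have hmR : (0 : ℝ) < m := by exact_mod_cast hm0
  have hm2 : (2 : ℝ) ≤ m := by exact_mod_cast (by omega : 2 ≤ m)
  have hkm : (k : ℝ) ≤ m := by exact_mod_cast hk hm0.ne'
  have hsin : 0 < Real.sin (Real.pi / m) := by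
    apply Real.sin_pos_of_pos_of_lt_pi (by positivity)
    rw [div_lt_iff₀ hmR]
    nlinarith [Real.pi_pos]
  refine nonneg_of_mul_nonneg_left ?_ hsin
  rw [dihedralCoeff_mul_sin]
  apply Real.sin_nonneg_of_nonneg_of_le_pi (by positivity)
  rw [← mul_div_assoc, div_le_iff₀ hmR]
  nlinarith [Real.pi_pos]

/-- The word ends in `s`. Each new letter on the left raises the smaller of the two consecutive
indices by 2, through the three-term recursion; parity tells which root carries it. -/
lemma geomRep_alternatingWord_simpleRoot (r s : B) (k : ℕ) :
    cs.geomRep (cs.wordProd (alternatingWord r s k)) (M.simpleRoot r) =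
      dihedralCoeff (Real.cos (Real.pi / M r s)) (if Even k then k + 1 else k) • M.simpleRoot r +
      dihedralCoeff (Real.cos (Real.pi / M r s)) (if Even k then k else k + 1) •
        M.simpleRoot s := by
  induction k with
  | zero => simp [alternatingWord, dihedralCoeff]
  | succ k ih =>
    rw [alternatingWord_succ', wordProd_cons, map_mul, LinearEquiv.mul_apply, ih]
    by_cases hk : Even k
    · simp only [hk, if_true, Nat.even_add_one, not_true, if_false, map_add, map_smul,
        geomRep_simple_simpleRoot_self, geomRep_simple_simpleRoot, M.symmetric s r,
        dihedralCoeff]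
      module
    · simp only [hk, if_false, Nat.even_add_one, not_false_iff, if_true, map_add, map_smul,
        geomRep_simple_simpleRoot_self, geomRep_simple_simpleRoot,
        dihedralCoeff]
      module

/-- Every element is a product, additive in length, of an element without right descents `r`, `s`
and an alternating word in `r`, `s`. -/
lemma exists_mul_alternatingWord {w : W} {r s : B} (hs : cs.IsRightDescent w s) :
    ∃ (v : W) (k : ℕ), 0 < k ∧ w = v * cs.wordProd (alternatingWord r s k) ∧
      cs.length w = cs.length v + k ∧ ¬ cs.IsRightDescent v r ∧ ¬ cs.IsRightDescent v s := by
  classical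
  -- Take the longest alternating suffix. A descent of `v` at the next letter would extend it; a
  -- descent at the suffix's first letter would cancel there and make `w` too short.
  let P : ℕ → Prop := fun k => 0 < k ∧ ∃ v, w = v * cs.wordProd (alternatingWord r s k) ∧
    cs.length w = cs.length v + k
  have h1 : P 1 := ⟨one_pos, w * cs.simple s, by simp [alternatingWord], by
    have := cs.isRightDescent_iff.mp hs; omega⟩
  have hb : ∀ k, P k → k ≤ cs.length w := by rintro k ⟨-, v, -, h⟩; omega
  have hP : P (Nat.findGreatest P (cs.length w)) := Nat.findGreatest_spec (hb 1 h1) h1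
  have hmax : ¬ P (Nat.findGreatest P (cs.length w) + 1) := fun h =>
    absurd (Nat.le_findGreatest (hb _ h) h) (by omega)
  generalize Nat.findGreatest P (cs.length w) = k at hP hmax
  obtain ⟨hk, v, hv, hl⟩ := hP
  have key₁ : ¬ cs.IsRightDescent v (if Even k then s else r) := by
    intro hd
    refine hmax ⟨by omega, v * cs.simple (if Even k then s else r), ?_, ?_⟩
    · rw [alternatingWord_succ', wordProd_cons, hv]
      simp [mul_assoc]
    · have := cs.isRightDescent_iff.mp hd; omega
  have key₂ : ¬ cs.IsRightDescent v (if Even k then r else s) := by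
    intro hd
    obtain ⟨n, rfl⟩ : ∃ n, k = n + 1 := ⟨k - 1, by omega⟩
    have e : (if Even (n + 1) then r else s) = if Even n then s else r := by
      by_cases h : Even n <;> simp [h, Nat.even_add_one]
    rw [e] at hd
    rw [alternatingWord_succ', wordProd_cons, ← mul_assoc] at hv
    have h2 := cs.length_mul_le (v * cs.simple (if Even n then s else r))
      (cs.wordProd (alternatingWord r s n))
    have h3 := cs.length_wordProd_le (alternatingWord r s n)
    rw [length_alternatingWord] at h3
    have h4 := cs.isRightDescent_iff.mp hd
    rw [← hv] at h2
    omega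
  refine ⟨v, k, hk, hv, hl, ?_⟩
  by_cases h : Even k <;> simp only [h, if_true, if_false] at key₁ key₂
  exacts [⟨key₂, key₁⟩, ⟨key₁, key₂⟩]

lemma alternatingWord_add (r s : B) (j k : ℕ) :
    ∃ ω : List B, ω.length = j ∧ alternatingWord r s (j + k) = ω ++ alternatingWord r s k := by
  induction j with
  | zero => exact ⟨[], by simp⟩
  | succ j ih =>
    obtain ⟨ω, hω, h⟩ := ih
    rw [show j + 1 + k = j + k + 1 by omega, alternatingWord_succ', h]
    exact ⟨(if Even (j + k) then s else r) :: ω, by simp [hω], by simp⟩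

/-- By the braid relation the last `M r s` letters can be made to end in `r`, which then cancels. -/
lemma length_wordProd_alternatingWord_mul_simple_lt {r s : B} {m j : ℕ} (hm : M r s = m + 1) :
    cs.length (cs.wordProd (alternatingWord r s (j + M r s)) * cs.simple r) < j + M r s := by
  obtain ⟨ω, hω, h⟩ := alternatingWord_add r s j (M r s)
  have hb : cs.wordProd (alternatingWord r s (M r s)) =
      cs.wordProd (alternatingWord s r (M r s)) := by
    have := cs.wordProd_braidWord_eq r s
    rwa [braidWord, braidWord, M.symmetric s r] at this
  rw [h, wordProd_append, hb, hm, alternatingWord_succ, wordProd_concat]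
  have h1 := cs.length_mul_le (cs.wordProd ω) (cs.wordProd (alternatingWord r s m))
  have h2 := cs.length_wordProd_le ω
  have h3 := cs.length_wordProd_le (alternatingWord r s m)
  rw [length_alternatingWord] at h3
  simp only [mul_assoc, simple_mul_simple_self, mul_one]
  omega

lemma simpleRoot_nonneg (s : B) : 0 ≤ M.simpleRoot s := by
  simp [CoxeterMatrix.simpleRoot]

/-- If `w s` is longer than `w`, then `w α_s` is a nonnegative combination of simple roots. -/
theorem geomRep_simpleRoot_nonneg {w : W} {r : B} (h : ¬ cs.IsRightDescent w r) :
    0 ≤ cs.geomRep w (M.simpleRoot r) := by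
  induction hn : cs.length w using Nat.strong_induction_on generalizing w r with
  | _ n ih =>
    by_cases hw : w = 1
    · subst hw; simpa using simpleRoot_nonneg r
    obtain ⟨s, hs⟩ := cs.exists_rightDescent_of_ne_one hw
    have hrs : r ≠ s := by rintro rfl; exact h hs
    obtain ⟨v, k, hk, rfl, hl, hvr, hvs⟩ := cs.exists_mul_alternatingWord (r := r) hs
    -- Otherwise the braid relation would make `r` a descent of `w`. The bound keeps both dihedral
    -- coefficients nonnegative, and induction applies to the shorter `v`.
    have hkm : M r s ≠ 0 → k < M r s := by
      intro h0
      by_contra! hle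
      obtain ⟨m, hm⟩ := Nat.exists_eq_succ_of_ne_zero h0
      obtain ⟨j, rfl⟩ : ∃ j, k = j + M r s := ⟨k - M r s, by omega⟩
      have h1 := cs.length_wordProd_alternatingWord_mul_simple_lt (j := j) hm
      have h2 := cs.length_mul_le v (cs.wordProd (alternatingWord r s (j + M r s)) * cs.simple r)
      rw [← mul_assoc] at h2
      exact h (by unfold IsRightDescent; omega)
    rw [map_mul, LinearEquiv.mul_apply, geomRep_alternatingWord_simpleRoot, map_add, map_smul,
      map_smul]
    have hm1 := M.off_diagonal r s hrs
    refine add_nonneg (smul_nonneg (dihedralCoeff_nonneg hm1 ?_) (ih _ (by omega) hvr rfl))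
      (smul_nonneg (dihedralCoeff_nonneg hm1 ?_) (ih _ (by omega) hvs rfl))
    all_goals
      intro h0
      have := hkm h0
      split_ifs <;> omega

end CoxeterSystem

namespace CoxeterSystem

variable {B W : Type*} [Group W] {M : CoxeterMatrix B} (cs : CoxeterSystem M W)

/-! ### Positive and negative roots -/

lemma form_comm (u v : B →₀ ℝ) : M.form u v = M.form v u := by
  have : M.form = M.form.flip := by
    ext s t
    have := M.form_simpleRoot s t
    have := M.form_simpleRoot t s
    simp_all [CoxeterMatrix.simpleRoot, M.symmetric t s]
  conv_lhs => rw [this]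
  rfl

lemma form_geomRep (w : W) (u v : B →₀ ℝ) :
    M.form (cs.geomRep w u) (cs.geomRep w v) = M.form u v := by
  induction w using cs.simple_induction_left generalizing u v with
  | one => simp
  | mul_simple_left w s ih =>
    rw [map_mul, LinearEquiv.mul_apply, LinearEquiv.mul_apply, ← ih u v, geomRep_simple,
      CoxeterMatrix.simpleReflection_apply, CoxeterMatrix.simpleReflection_apply]
    have h := M.form_simpleRoot s s
    rw [M.diagonal] at h
    simp only [map_sub, map_smul, LinearMap.sub_apply, LinearMap.smul_apply, h,
      form_comm (M.simpleRoot s), smul_eq_mul]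
    simp
    ring

variable {cs} {α β γ : B →₀ ℝ}

lemma form_self_of_mem_roots (h : α ∈ cs.roots) : M.form α α = 1 := by
  obtain ⟨w, s, rfl⟩ := h
  rw [form_geomRep, M.form_simpleRoot, M.diagonal]
  simp

lemma ne_zero_of_mem_roots (h : α ∈ cs.roots) : α ≠ 0 := by
  rintro rfl
  simpa using form_self_of_mem_roots h

lemma geomRep_mem_roots (h : α ∈ cs.roots) (w : W) : cs.geomRep w α ∈ cs.roots := by
  obtain ⟨v, s, rfl⟩ := h
  exact ⟨w * v, s, by rw [map_mul, LinearEquiv.mul_apply]⟩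

lemma neg_mem_roots (h : α ∈ cs.roots) : -α ∈ cs.roots := by
  obtain ⟨v, s, rfl⟩ := h
  exact ⟨v * cs.simple s, s, by rw [geomRep_mul_simple_simpleRoot]⟩

lemma simpleRoot_mem_posRoots (s : B) : M.simpleRoot s ∈ cs.posRoots :=
  ⟨⟨1, s, by simp⟩, simpleRoot_nonneg s⟩

lemma geomRep_mem_posRoots {w : W} {s : B} (h : ¬ cs.IsRightDescent w s) :
    cs.geomRep w (M.simpleRoot s) ∈ cs.posRoots :=
  ⟨⟨w, s, rfl⟩, cs.geomRep_simpleRoot_nonneg h⟩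

lemma neg_mem_posRoots_iff : -α ∈ cs.posRoots ↔ α ∈ cs.negRoots := by
  simp only [posRoots, negRoots, Set.mem_ofPred_eq, Finsupp.neg_apply, Left.nonneg_neg_iff]
  refine and_congr_left fun _ => ⟨fun h => ?_, neg_mem_roots⟩
  simpa using neg_mem_roots h

lemma neg_mem_negRoots_iff : -α ∈ cs.negRoots ↔ α ∈ cs.posRoots := by
  rw [← neg_mem_posRoots_iff, neg_neg]

lemma mem_posRoots_or_mem_negRoots (h : α ∈ cs.roots) : α ∈ cs.posRoots ∨ α ∈ cs.negRoots := by
  obtain ⟨w, s, rfl⟩ := h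
  by_cases hd : cs.IsRightDescent w s
  · right
    rw [← neg_mem_posRoots_iff, ← geomRep_mul_simple_simpleRoot]
    exact geomRep_mem_posRoots (cs.isRightDescent_iff_not_isRightDescent_mul.mp hd)
  · exact .inl (geomRep_mem_posRoots hd)

lemma not_mem_negRoots (h : α ∈ cs.posRoots) : α ∉ cs.negRoots := fun h' =>
  ne_zero_of_mem_roots h.1 (Finsupp.ext fun s => le_antisymm (h'.2 s) (h.2 s))

lemma mem_negRoots_iff (h : α ∈ cs.roots) : α ∈ cs.negRoots ↔ α ∉ cs.posRoots :=
  ⟨fun h₁ h₂ => not_mem_negRoots h₂ h₁, (mem_posRoots_or_mem_negRoots h).resolve_left⟩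

lemma isRightDescent_iff_mem_negRoots {w : W} {s : B} :
    cs.IsRightDescent w s ↔ cs.geomRep w (M.simpleRoot s) ∈ cs.negRoots := by
  refine ⟨fun h => ?_, fun h => by_contra fun hd => not_mem_negRoots (geomRep_mem_posRoots hd) h⟩
  rw [← neg_mem_posRoots_iff, ← geomRep_mul_simple_simpleRoot]
  exact geomRep_mem_posRoots (cs.isRightDescent_iff_not_isRightDescent_mul.mp h)

/-- A simple reflection permutes the positive roots other than its own root. -/
lemma geomRep_simple_mem_posRoots (h : α ∈ cs.posRoots) {s : B} (hs : α ≠ M.simpleRoot s) :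
    cs.geomRep (cs.simple s) α ∈ cs.posRoots := by
  refine (mem_posRoots_or_mem_negRoots (geomRep_mem_roots h.1 _)).resolve_right fun hneg => hs ?_
  -- `s` changes only the `α_s` coordinate, so all others are both `≥ 0` and `≤ 0`. Norm 1 then
  -- forces `α = α_s`.
  have hzero : ∀ t ≠ s, α t = 0 := by
    intro t ht
    refine le_antisymm ?_ (h.2 t)
    have := hneg.2 t
    rw [geomRep_simple, CoxeterMatrix.simpleReflection_apply] at this
    simpa [CoxeterMatrix.simpleRoot, Finsupp.single_apply, ht.symm] using this
  have hα : α = α s • M.simpleRoot s := by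
    ext t
    by_cases ht : t = s
    · subst ht; simp [CoxeterMatrix.simpleRoot]
    · simp [CoxeterMatrix.simpleRoot, hzero t ht, Ne.symm ht]
  have hn := form_self_of_mem_roots h.1
  rw [hα, map_smul, map_smul, LinearMap.smul_apply, M.form_simpleRoot, M.diagonal] at hn
  simp only [Nat.cast_one, div_one, Real.cos_pi, neg_neg, smul_eq_mul, mul_one] at hn
  have h1 : α s = 1 := by nlinarith [h.2 s]
  rw [hα, h1, one_smul]

/-! ### Inversion sets -/

lemma geomRep_mul_apply (v w : W) (α : B →₀ ℝ) :
    cs.geomRep (v * w) α = cs.geomRep v (cs.geomRep w α) := by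
  rw [map_mul, LinearEquiv.mul_apply]

lemma geomRep_inv_geomRep (w : W) (α : B →₀ ℝ) : cs.geomRep w⁻¹ (cs.geomRep w α) = α := by
  rw [← geomRep_mul_apply]; simp

lemma geomRep_geomRep_inv (w : W) (α : B →₀ ℝ) : cs.geomRep w (cs.geomRep w⁻¹ α) = α := by
  rw [← geomRep_mul_apply]; simp

lemma geomRep_simple_geomRep_simple (s : B) (α : B →₀ ℝ) :
    cs.geomRep (cs.simple s) (cs.geomRep (cs.simple s) α) = α := by
  rw [← geomRep_mul_apply]; simp

lemma simpleRoot_mem_inversionSet_iff {w : W} {s : B} :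
    M.simpleRoot s ∈ cs.inversionSet w ↔ cs.IsLeftDescent w s := by
  rw [← isRightDescent_inv_iff, isRightDescent_iff_mem_negRoots]
  exact and_iff_right (simpleRoot_mem_posRoots s)

lemma not_mem_inversionSet_iff {w : W} (h : β ∈ cs.posRoots) :
    β ∉ cs.inversionSet w ↔ cs.geomRep w⁻¹ β ∈ cs.posRoots := by
  rw [inversionSet, Set.mem_ofPred_eq, and_iff_right h, mem_negRoots_iff (geomRep_mem_roots h.1 _),
    not_not]

lemma inversionSet_one : cs.inversionSet 1 = ∅ := by
  ext β
  simp only [Set.mem_empty_iff_false, iff_false]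
  rintro ⟨h₁, h₂⟩
  exact not_mem_negRoots h₁ (by simpa using h₂)

lemma mem_inversionSet_simple_mul {w : W} {s : B} (h : β ∈ cs.posRoots)
    (hβ : β ≠ M.simpleRoot s) :
    β ∈ cs.inversionSet (cs.simple s * w) ↔ cs.geomRep (cs.simple s) β ∈ cs.inversionSet w := by
  simp only [inversionSet, Set.mem_ofPred_eq, mul_inv_rev, inv_simple, geomRep_mul_apply]
  exact and_congr_left fun _ => iff_of_true h (geomRep_simple_mem_posRoots h hβ)

lemma geomRep_simple_ne_simpleRoot (h : β ∈ cs.posRoots) (s : B) :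
    cs.geomRep (cs.simple s) β ≠ M.simpleRoot s := by
  intro h₀
  have h₁ : β = -M.simpleRoot s := by
    rw [← geomRep_simple_geomRep_simple (cs := cs) s β, h₀, geomRep_simple_simpleRoot_self]
  subst h₁
  exact not_mem_negRoots h (neg_mem_negRoots_iff.mpr (simpleRoot_mem_posRoots s))

/-- Lengths add up in a product `a b` if and only if the inversion sets of `a⁻¹` and `b` are
disjoint. -/
theorem length_mul_eq_add_iff (a b : W) :
    cs.length (a * b) = cs.length a + cs.length b ↔
      Disjoint (cs.inversionSet a⁻¹) (cs.inversionSet b) := by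
  induction hn : cs.length a generalizing a b with
  | zero =>
    obtain rfl := cs.length_eq_zero_iff.mp hn
    simp [inversionSet_one]
  | succ n ih =>
    have ha : a ≠ 1 := by rintro rfl; simp at hn
    obtain ⟨s, hs⟩ := cs.exists_rightDescent_of_ne_one ha
    obtain ⟨c, rfl⟩ : ∃ c, a = c * cs.simple s := ⟨a * cs.simple s, by simp⟩
    have hcs := cs.isRightDescent_iff_not_isRightDescent_mul.mp hs
    rw [simple_mul_simple_cancel_right] at hcs
    have hc : cs.length c = n := by
      have := cs.not_isRightDescent_iff.mp hcs; omega
    have hsc : M.simpleRoot s ∉ cs.inversionSet c⁻¹ := by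
      rwa [simpleRoot_mem_inversionSet_iff, isLeftDescent_inv_iff]
    have hsa : M.simpleRoot s ∈ cs.inversionSet (c * cs.simple s)⁻¹ := by
      rwa [simpleRoot_mem_inversionSet_iff, isLeftDescent_inv_iff]
    -- Move the last letter `s` of `a` over to `b`. Away from `α_s`, this just applies `s` to both
    -- inversion sets.
    have key : cs.length (c * cs.simple s * b) = n + 1 + cs.length b ↔
        ¬ cs.IsLeftDescent b s ∧
          cs.length (c * (cs.simple s * b)) = n + cs.length (cs.simple s * b) := by
      rw [cs.not_isLeftDescent_iff, mul_assoc]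
      have h₁ := cs.length_mul_le c (cs.simple s * b)
      have h₂ := cs.length_simple_mul b s
      omega
    rw [key, ih c _ hc, ← simpleRoot_mem_inversionSet_iff, Set.disjoint_left, Set.disjoint_left]
    rw [mul_inv_rev, inv_simple] at hsa ⊢
    constructor
    · rintro ⟨hb, h⟩ β hβ hβb
      have hne : β ≠ M.simpleRoot s := by rintro rfl; exact hb hβb
      refine h ((mem_inversionSet_simple_mul hβ.1 hne).mp hβ) ?_
      refine (mem_inversionSet_simple_mul (geomRep_simple_mem_posRoots hβ.1 hne)
        (geomRep_simple_ne_simpleRoot hβ.1 s)).mpr ?_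
      rwa [geomRep_simple_geomRep_simple]
    · intro h
      refine ⟨h hsa, fun β hβ hβb => ?_⟩
      have hne : β ≠ M.simpleRoot s := by rintro rfl; exact hsc hβ
      refine h ?_ ((mem_inversionSet_simple_mul hβ.1 hne).mp hβb)
      refine (mem_inversionSet_simple_mul (geomRep_simple_mem_posRoots hβ.1 hne)
        (geomRep_simple_ne_simpleRoot hβ.1 s)).mpr ?_
      rwa [geomRep_simple_geomRep_simple]

lemma mem_coneType_inv_iff {x v : W} :
    v ∈ cs.coneType x⁻¹ ↔ Disjoint (cs.inversionSet x) (cs.inversionSet v) := by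
  rw [coneType, Set.mem_ofPred_eq, length_mul_eq_add_iff, inv_inv]

/-! ### The right weak order -/

/-- If `y` did not invert `β`, then `-x⁻¹β` would be a common inversion of `x⁻¹` and `x⁻¹y`. -/
lemma RightWeakLE.inversionSet_subset {x y : W} (h : cs.RightWeakLE x y) :
    cs.inversionSet x ⊆ cs.inversionSet y := by
  intro β hβ
  have hd : Disjoint (cs.inversionSet x⁻¹) (cs.inversionSet (x⁻¹ * y)) := by
    rw [← length_mul_eq_add_iff, mul_inv_cancel_left]; exact h
  have h₁ : -cs.geomRep x⁻¹ β ∈ cs.posRoots := neg_mem_posRoots_iff.mpr hβ.2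
  have h₂ : -cs.geomRep x⁻¹ β ∈ cs.inversionSet x⁻¹ := by
    refine ⟨h₁, ?_⟩
    rw [map_neg, inv_inv, geomRep_geomRep_inv]
    exact neg_mem_negRoots_iff.mpr hβ.1
  have h₃ := (not_mem_inversionSet_iff h₁).mp (Set.disjoint_left.mp hd h₂)
  rw [map_neg, ← geomRep_mul_apply, neg_mem_posRoots_iff] at h₃
  exact ⟨hβ.1, by simpa using h₃⟩

variable (cs) in
lemma RightWeakLE.refl (x : W) : cs.RightWeakLE x x := by simp [RightWeakLE]

variable (cs) in
lemma one_rightWeakLE (x : W) : cs.RightWeakLE 1 x := by simp [RightWeakLE]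

lemma RightWeakLE.trans {x y z : W} (h₁ : cs.RightWeakLE x y) (h₂ : cs.RightWeakLE y z) :
    cs.RightWeakLE x z := by
  unfold RightWeakLE at *
  have h₃ := cs.length_mul_le (x⁻¹ * y) (y⁻¹ * z)
  have h₄ := cs.length_mul_le x (x⁻¹ * z)
  rw [mul_inv_cancel_left] at h₄
  rw [mul_assoc, mul_inv_cancel_left] at h₃
  omega

lemma RightWeakLE.length_lt {x y : W} (h : cs.RightWeakLE x y) (hne : y ≠ x) :
    cs.length x < cs.length y := by
  unfold RightWeakLE at h
  have : cs.length (x⁻¹ * y) ≠ 0 := by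
    rw [Ne, length_eq_zero_iff, inv_mul_eq_one]; exact hne.symm
  omega

lemma RightWeakLE.antisymm {x y : W} (h₁ : cs.RightWeakLE x y) (h₂ : cs.RightWeakLE y x) :
    x = y := by
  by_contra hne
  have := h₁.length_lt (Ne.symm hne)
  have := h₂.length_lt hne
  omega

lemma simple_rightWeakLE_iff {s : B} {w : W} :
    cs.RightWeakLE (cs.simple s) w ↔ cs.IsLeftDescent w s := by
  rw [RightWeakLE, isLeftDescent_iff, length_simple, inv_simple]
  omega

lemma simple_mul_rightWeakLE_simple_mul_iff {s : B} {x y : W} (hx : cs.IsLeftDescent x s)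
    (hy : cs.IsLeftDescent y s) :
    cs.RightWeakLE (cs.simple s * x) (cs.simple s * y) ↔ cs.RightWeakLE x y := by
  rw [isLeftDescent_iff] at hx hy
  rw [RightWeakLE, RightWeakLE, mul_inv_rev, inv_simple, mul_assoc, simple_mul_simple_cancel_left]
  omega

lemma mul_simple_rightWeakLE {x : W} {s : B} (h : cs.IsRightDescent x s) :
    cs.RightWeakLE (x * cs.simple s) x := by
  rw [isRightDescent_iff] at h
  rw [RightWeakLE, mul_inv_rev, inv_simple, mul_assoc, inv_mul_cancel, mul_one, length_simple]
  omega

lemma isGate_iff {X : Set W} {x : W} :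
    cs.IsGate X x ↔ x ∈ X ∧ ∀ y ∈ X, cs.RightWeakLE x y :=
  ⟨fun h => ⟨h.1.1, h.2⟩, fun h => ⟨⟨h.1, fun y hy hne => (h.2 y hy).length_lt hne⟩, h.2⟩⟩

/-! ### Joins of elements with a common upper bound -/

variable (cs) in
/-- Inverses of the suffixes of an alternating word are ordered by length. -/
lemma alternatingWord_rightWeakLE {r s : B} {j k : ℕ} (hjk : j ≤ k)
    (hk : cs.length (cs.wordProd (alternatingWord r s k)) = k) :
    cs.RightWeakLE (cs.wordProd (alternatingWord r s j))⁻¹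
      (cs.wordProd (alternatingWord r s k))⁻¹ := by
  obtain ⟨i, rfl⟩ : ∃ i, k = i + j := ⟨k - j, by omega⟩
  obtain ⟨ω, hω, h⟩ := alternatingWord_add r s i j
  have h₁ := cs.length_wordProd_le ω
  have h₂ := cs.length_wordProd_le (alternatingWord r s j)
  rw [length_alternatingWord] at h₂
  rw [h, wordProd_append] at hk
  have h₃ := cs.length_mul_le (cs.wordProd ω) (cs.wordProd (alternatingWord r s j))
  rw [RightWeakLE, h, wordProd_append, mul_inv_rev, inv_inv, mul_inv_cancel_left, length_inv,
    length_inv, ← mul_inv_rev, length_inv, hk]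
  omega

variable (cs) in
/-- An element with left descents `r` and `s` lies above an alternating element with left
descents `r` and `s`. -/
lemma exists_alternatingWord_rightWeakLE {r s : B} (hrs : r ≠ s) {y : W}
    (hr : cs.IsLeftDescent y r) (hs : cs.IsLeftDescent y s) :
    ∃ k, cs.length (cs.wordProd (alternatingWord r s k)) = k ∧
      cs.IsRightDescent (cs.wordProd (alternatingWord r s k)) r ∧
      cs.IsRightDescent (cs.wordProd (alternatingWord r s k)) s ∧
      cs.RightWeakLE (cs.wordProd (alternatingWord r s k))⁻¹ y := by
  obtain ⟨w, rfl⟩ : ∃ w, y = w⁻¹ := ⟨y⁻¹, by simp⟩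
  rw [isLeftDescent_inv_iff] at hr hs
  obtain ⟨v, k, hk, rfl, hl, hvr, hvs⟩ := cs.exists_mul_alternatingWord (r := r) hs
  have h₁ := cs.length_wordProd_le (alternatingWord r s k)
  rw [length_alternatingWord] at h₁
  have h₂ := cs.length_mul_le v (cs.wordProd (alternatingWord r s k))
  have hlk : cs.length (cs.wordProd (alternatingWord r s k)) = k := by omega
  refine ⟨k, hlk, ?_, ?_, ?_⟩
  -- If `r` were no descent of the alternating part, that part would send `α_r` to a nonnegative
  -- combination of `α_r` and `α_s`, which `v` keeps nonnegative.
  · by_contra hnr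
    have h₃ := cs.geomRep_simpleRoot_nonneg hnr
    have h₄ := cs.geomRep_alternatingWord_simpleRoot r s k
    rw [isRightDescent_iff_mem_negRoots, geomRep_mul_apply, h₄] at hr
    rw [h₄] at h₃
    have hcr := h₃ r
    have hcs := h₃ s
    simp only [CoxeterMatrix.simpleRoot, Finsupp.coe_zero, Pi.zero_apply, Finsupp.add_apply,
      Finsupp.smul_apply, Finsupp.single_eq_same, Finsupp.single_eq_of_ne hrs,
      Finsupp.single_eq_of_ne hrs.symm, smul_eq_mul, mul_one, mul_zero, add_zero, zero_add] at hcr hcs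
    refine not_mem_negRoots ⟨hr.1, ?_⟩ hr
    rw [map_add, map_smul, map_smul]
    exact add_nonneg (smul_nonneg hcr (cs.geomRep_simpleRoot_nonneg hvr))
      (smul_nonneg hcs (cs.geomRep_simpleRoot_nonneg hvs))
  · obtain ⟨n, rfl⟩ := Nat.exists_eq_succ_of_ne_zero hk.ne'
    have h₃ := cs.length_wordProd_le (alternatingWord s r n)
    rw [length_alternatingWord] at h₃
    rw [IsRightDescent, hlk, alternatingWord_succ, wordProd_concat, simple_mul_simple_cancel_right]
    omega
  · rw [RightWeakLE, inv_inv, length_inv, length_inv, mul_inv_rev, mul_inv_cancel_left, length_inv]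
    omega

variable (cs) in
/-- Two simple reflections with a common upper bound in the weak order have a join. -/
lemma exists_join_simple (r s : B) {w : W} (hr : cs.IsLeftDescent w r)
    (hs : cs.IsLeftDescent w s) :
    ∃ u, cs.IsLeftDescent u r ∧ cs.IsLeftDescent u s ∧
      ∀ y, cs.IsLeftDescent y r → cs.IsLeftDescent y s → cs.RightWeakLE u y := by
  classical
  by_cases hrs : r = s
  · subst hrs
    have h : cs.IsLeftDescent (cs.simple r) r := simple_rightWeakLE_iff.mp (.refl cs _)
    exact ⟨_, h, h, fun y hy _ => simple_rightWeakLE_iff.mpr hy⟩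
  -- These alternating elements form a chain, so the one with least `k` lies below all upper bounds.
  let P : ℕ → Prop := fun k => cs.length (cs.wordProd (alternatingWord r s k)) = k ∧
      cs.IsRightDescent (cs.wordProd (alternatingWord r s k)) r ∧
      cs.IsRightDescent (cs.wordProd (alternatingWord r s k)) s
  have hP : ∃ k, P k :=
    let ⟨k, h₁, h₂, h₃, _⟩ := cs.exists_alternatingWord_rightWeakLE hrs hr hs
    ⟨k, h₁, h₂, h₃⟩
  obtain ⟨-, h₂, h₃⟩ := Nat.find_spec hP
  refine ⟨(cs.wordProd (alternatingWord r s (Nat.find hP)))⁻¹, cs.isLeftDescent_inv_iff.mpr h₂,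
    cs.isLeftDescent_inv_iff.mpr h₃, fun y hyr hys => ?_⟩
  obtain ⟨k, h₁, h₂, h₃, h₄⟩ := cs.exists_alternatingWord_rightWeakLE hrs hyr hys
  exact (cs.alternatingWord_rightWeakLE (Nat.find_min' hP ⟨h₁, h₂, h₃⟩) h₁).trans h₄

variable (cs) in
/-- Two elements with a common upper bound in the weak order have a join. -/
theorem exists_join {g h w : W} (hg : cs.RightWeakLE g w) (hh : cs.RightWeakLE h w) :
    ∃ j, cs.RightWeakLE g j ∧ cs.RightWeakLE h j ∧
      ∀ y, cs.RightWeakLE g y → cs.RightWeakLE h y → cs.RightWeakLE j y := by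
  induction hn : cs.length w using Nat.strong_induction_on generalizing g h w with
  | _ n ih =>
    -- With a common left descent `s`, cancel it and use induction below `s * w`. The join found
    -- there cannot have descent `s`, since `s * w` has not.
    have common : ∀ (s : B) (g h : W), cs.IsLeftDescent g s → cs.IsLeftDescent h s →
        cs.RightWeakLE g w → cs.RightWeakLE h w →
        ∃ j, cs.RightWeakLE g j ∧ cs.RightWeakLE h j ∧
          ∀ y, cs.RightWeakLE g y → cs.RightWeakLE h y → cs.RightWeakLE j y := by
      intro s g h hgs hhs hg hh
      have above : ∀ {y}, cs.RightWeakLE g y → cs.IsLeftDescent y s := fun hy =>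
        simple_rightWeakLE_iff.mp ((simple_rightWeakLE_iff.mpr hgs).trans hy)
      have hws := above hg
      obtain ⟨j, hgj, hhj, hj⟩ := ih (cs.length (cs.simple s * w)) (hn ▸ hws)
        ((simple_mul_rightWeakLE_simple_mul_iff hgs hws).mpr hg)
        ((simple_mul_rightWeakLE_simple_mul_iff hhs hws).mpr hh) rfl
      have hjs : cs.IsLeftDescent (cs.simple s * j) s := by
        rw [isLeftDescent_iff_not_isLeftDescent_mul, simple_mul_simple_cancel_left]
        intro hjs
        have h₁ := (simple_rightWeakLE_iff.mpr hjs).trans (hj (cs.simple s * w)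
          ((simple_mul_rightWeakLE_simple_mul_iff hgs hws).mpr hg)
          ((simple_mul_rightWeakLE_simple_mul_iff hhs hws).mpr hh))
        exact cs.isLeftDescent_iff_not_isLeftDescent_mul.mp hws (simple_rightWeakLE_iff.mp h₁)
      refine ⟨cs.simple s * j, ?_, ?_, fun y hgy hhy => ?_⟩
      · rw [← simple_mul_rightWeakLE_simple_mul_iff hgs hjs, simple_mul_simple_cancel_left]
        exact hgj
      · rw [← simple_mul_rightWeakLE_simple_mul_iff hhs hjs, simple_mul_simple_cancel_left]
        exact hhj
      · have hys := above hgy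
        rw [← simple_mul_rightWeakLE_simple_mul_iff hjs hys, simple_mul_simple_cancel_left]
        exact hj _ ((simple_mul_rightWeakLE_simple_mul_iff hgs hys).mpr hgy)
          ((simple_mul_rightWeakLE_simple_mul_iff hhs hys).mpr hhy)
    by_cases hg1 : g = 1
    · subst hg1
      exact ⟨h, one_rightWeakLE cs h, .refl cs h, fun _ _ h => h⟩
    by_cases hh1 : h = 1
    · subst hh1
      exact ⟨g, .refl cs g, one_rightWeakLE cs g, fun _ h _ => h⟩
    obtain ⟨r, hr⟩ := cs.exists_leftDescent_of_ne_one hg1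
    obtain ⟨s, hs⟩ := cs.exists_leftDescent_of_ne_one hh1
    have aboveg : ∀ {y}, cs.RightWeakLE g y → cs.IsLeftDescent y r := fun hy =>
      simple_rightWeakLE_iff.mp ((simple_rightWeakLE_iff.mpr hr).trans hy)
    have aboveh : ∀ {y}, cs.RightWeakLE h y → cs.IsLeftDescent y s := fun hy =>
      simple_rightWeakLE_iff.mp ((simple_rightWeakLE_iff.mpr hs).trans hy)
    obtain ⟨u, hur, hus, hu⟩ := cs.exists_join_simple r s (aboveg hg) (aboveh hh)
    have huw := hu w (aboveg hg) (aboveh hh)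
    -- `u` shares `r` with `g` and `s` with `h`, and the two resulting joins share `r`; so three
    -- uses of `common` suffice.
    obtain ⟨j₁, hg₁, hu₁, hj₁⟩ := common r g u hr hur hg huw
    obtain ⟨j₂, hh₂, hu₂, hj₂⟩ := common s h u hs hus hh huw
    obtain ⟨j, h₁, h₂, hj⟩ := common r j₁ j₂ (aboveg hg₁)
      (simple_rightWeakLE_iff.mp ((simple_rightWeakLE_iff.mpr hur).trans hu₂))
      (hj₁ w hg huw) (hj₂ w hh huw)
    refine ⟨j, hg₁.trans h₁, hh₂.trans h₂, fun y hgy hhy => ?_⟩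
    have huy := hu y (aboveg hgy) (aboveh hhy)
    exact hj y (hj₁ y hgy huy) (hj₂ y hhy huy)

end CoxeterSystem

namespace CoxeterSystem

variable {B W : Type*} [Group W] {M : CoxeterMatrix B} {cs : CoxeterSystem M W} {β γ : B →₀ ℝ}

/-! ### Gates of the sets of witnesses -/

lemma mem_witnesses_iff {x y : W} :
    y ∈ cs.witnesses x β ↔ β ∈ cs.inversionSet x ∧ β ∈ cs.inversionSet y ∧
      ∀ γ ∈ cs.inversionSet x, γ ∈ cs.inversionSet y → γ = β := by
  rw [witnesses, Set.mem_ofPred_eq, Set.eq_singleton_iff_unique_mem]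
  simp only [Set.mem_inter_iff, and_imp, and_assoc]

lemma mem_witnesses_comm {x y : W} : y ∈ cs.witnesses x β ↔ x ∈ cs.witnesses y β := by
  rw [witnesses, witnesses, Set.mem_ofPred_eq, Set.mem_ofPred_eq, Set.inter_comm]

lemma mem_witnesses_of_rightWeakLE {x y z : W} (hy : y ∈ cs.witnesses x β)
    (hzy : cs.RightWeakLE z y) (hz : β ∈ cs.inversionSet z) : z ∈ cs.witnesses x β := by
  rw [mem_witnesses_iff] at hy ⊢
  exact ⟨hy.1, hz, fun γ hx hγ => hy.2.2 γ hx (hzy.inversionSet_subset hγ)⟩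

lemma geomRep_simple_mem_inversionSet_simple_mul {w : W} {s : B} (h : γ ∈ cs.posRoots)
    (hγ : γ ≠ M.simpleRoot s) :
    cs.geomRep (cs.simple s) γ ∈ cs.inversionSet (cs.simple s * w) ↔ γ ∈ cs.inversionSet w := by
  rw [mem_inversionSet_simple_mul (geomRep_simple_mem_posRoots h hγ)
    (geomRep_simple_ne_simpleRoot h s), geomRep_simple_geomRep_simple]

/-- As `α_s ∈ Φ(x)` differs from `β`, no witness inverts it. Applying `s` carries the common
inversions of `x` and `y` to those of `sx` and `sy`; the new root `α_s` of `Φ(sy)` is not in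
`Φ(sx)`. -/
lemma mem_witnesses_iff_simple_mul {x y : W} {s : B} (hx : cs.IsLeftDescent x s)
    (hβ : β ∈ cs.posRoots) (hβs : β ≠ M.simpleRoot s) :
    y ∈ cs.witnesses x β ↔ ¬ cs.IsLeftDescent y s ∧
      cs.simple s * y ∈ cs.witnesses (cs.simple s * x) (cs.geomRep (cs.simple s) β) := by
  simp only [mem_witnesses_iff, geomRep_simple_mem_inversionSet_simple_mul hβ hβs]
  constructor
  · rintro ⟨h₁, h₂, h₃⟩
    refine ⟨fun h => hβs (h₃ _ (simpleRoot_mem_inversionSet_iff.mpr hx)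
      (simpleRoot_mem_inversionSet_iff.mpr h)).symm, h₁, h₂, fun γ hγx hγy => ?_⟩
    have hγs : γ ≠ M.simpleRoot s := by
      rintro rfl
      exact cs.isLeftDescent_iff_not_isLeftDescent_mul.mp hx
        (simpleRoot_mem_inversionSet_iff.mp hγx)
    rw [← h₃ _ ((mem_inversionSet_simple_mul hγx.1 hγs).mp hγx)
      ((mem_inversionSet_simple_mul hγx.1 hγs).mp hγy), geomRep_simple_geomRep_simple]
  · rintro ⟨h₀, h₁, h₂, h₃⟩
    refine ⟨h₁, h₂, fun γ hγx hγy => ?_⟩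
    have hγs : γ ≠ M.simpleRoot s := by
      rintro rfl
      exact h₀ (simpleRoot_mem_inversionSet_iff.mp hγy)
    exact (cs.geomRep (cs.simple s)).injective
      (h₃ _ ((geomRep_simple_mem_inversionSet_simple_mul hγx.1 hγs).mpr hγx)
        ((geomRep_simple_mem_inversionSet_simple_mul hγx.1 hγs).mpr hγy))

/-- A nonempty set of witnesses has a gate. -/
theorem exists_isGate_witnesses {x : W} (hne : (cs.witnesses x β).Nonempty) :
    ∃ g, cs.IsGate (cs.witnesses x β) g := by
  induction hn : cs.length x using Nat.strong_induction_on generalizing x β with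
  | _ n ih =>
    obtain ⟨y, hy⟩ := hne
    have hβx := (mem_witnesses_iff.mp hy).1
    have hx1 : x ≠ 1 := by
      rintro rfl
      simp [inversionSet_one] at hβx
    obtain ⟨s, hs⟩ := cs.exists_leftDescent_of_ne_one hx1
    by_cases hβs : β = M.simpleRoot s
    · have above : ∀ z ∈ cs.witnesses x β, cs.RightWeakLE (cs.simple s) z := by
        intro z hz
        rw [simple_rightWeakLE_iff, ← simpleRoot_mem_inversionSet_iff, ← hβs]
        exact (mem_witnesses_iff.mp hz).2.1
      refine ⟨cs.simple s, isGate_iff.mpr ⟨mem_witnesses_of_rightWeakLE hy (above y hy) ?_, above⟩⟩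
      rw [hβs, simpleRoot_mem_inversionSet_iff, ← simple_rightWeakLE_iff]
      exact .refl cs _
    · have hiff : ∀ z, z ∈ cs.witnesses x β ↔ _ := fun z =>
        mem_witnesses_iff_simple_mul hs hβx.1 hβs
      have hdesc : ∀ z, ¬ cs.IsLeftDescent z s → cs.IsLeftDescent (cs.simple s * z) s := by
        intro z hz
        rwa [isLeftDescent_iff_not_isLeftDescent_mul, simple_mul_simple_cancel_left]
      obtain ⟨hy₁, hy₂⟩ := (hiff y).mp hy
      obtain ⟨g, hg⟩ := ih _ (hn ▸ hs) ⟨_, hy₂⟩ rfl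
      rw [isGate_iff] at hg
      -- `g` may lack the left descent `s` required of a translated witness. Its join with `s` has
      -- it, and remains a witness because it lies between `g` and `s * y`.
      obtain ⟨j, hgj, hsj, hj⟩ := cs.exists_join (hg.2 _ hy₂)
        (simple_rightWeakLE_iff.mpr (hdesc y hy₁))
      have hjmem := mem_witnesses_of_rightWeakLE hy₂
        (hj _ (hg.2 _ hy₂) (simple_rightWeakLE_iff.mpr (hdesc y hy₁)))
        (hgj.inversionSet_subset (mem_witnesses_iff.mp hg.1).2.1)
      have hsj' := simple_rightWeakLE_iff.mp hsj
      refine ⟨cs.simple s * j, isGate_iff.mpr ⟨(hiff _).mpr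
        ⟨cs.isLeftDescent_iff_not_isLeftDescent_mul.mp hsj', by simpa using hjmem⟩,
        fun z hz => ?_⟩⟩
      obtain ⟨hz₁, hz₂⟩ := (hiff z).mp hz
      have := (simple_mul_rightWeakLE_simple_mul_iff hsj' (hdesc z hz₁)).mpr
        (hj _ (hg.2 _ hz₂) (simple_rightWeakLE_iff.mpr (hdesc z hz₁)))
      simpa using this

/-! ### Right descents of gates and dependence on the cone type -/

/-- Passing from `y` to `ys` changes the side only for the roots `±yα_s`. -/
lemma mem_inversionSet_mul_simple {y : W} {s : B} (hγ : γ ∈ cs.inversionSet y)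
    (hne : γ ≠ -cs.geomRep y (M.simpleRoot s)) : γ ∈ cs.inversionSet (y * cs.simple s) := by
  refine ⟨hγ.1, ?_⟩
  rw [mul_inv_rev, inv_simple, geomRep_mul_apply, ← neg_mem_posRoots_iff, ← map_neg]
  refine geomRep_simple_mem_posRoots (neg_mem_posRoots_iff.mpr hγ.2) fun h₀ => hne ?_
  rw [← h₀, map_neg, neg_neg, geomRep_geomRep_inv]

/-- The only right descent root of the gate of a set of witnesses of `β` is `β`. -/
lemma IsGate.eq_neg_geomRep {x y : W} (h : cs.IsGate (cs.witnesses x β) y) {s : B}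
    (hs : cs.IsRightDescent y s) : β = -cs.geomRep y (M.simpleRoot s) := by
  by_contra hne
  have hmem : y * cs.simple s ∈ cs.witnesses x β :=
    mem_witnesses_of_rightWeakLE h.1.1 (mul_simple_rightWeakLE hs)
      (mem_inversionSet_mul_simple (mem_witnesses_iff.mp h.1.1).2.1 hne)
  have h₁ := h.2 _ hmem
  have h₂ := mul_simple_rightWeakLE hs
  have h₃ := h₁.antisymm h₂
  have h₄ : cs.length (y * cs.simple s) < cs.length y := hs
  rw [← h₃] at h₄
  omega

lemma ne_one_of_mem_witnesses {x y : W} (h : y ∈ cs.witnesses x β) : y ≠ 1 := by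
  rintro rfl
  simpa [inversionSet_one] using (mem_witnesses_iff.mp h).2.1

lemma IsGate.rightDescentRoots_eq {x y : W} (h : cs.IsGate (cs.witnesses x β) y) :
    cs.rightDescentRoots y = {β} := by
  obtain ⟨s, hs⟩ := cs.exists_rightDescent_of_ne_one (ne_one_of_mem_witnesses h.1.1)
  refine Set.eq_singleton_iff_unique_mem.mpr ⟨⟨s, hs, h.eq_neg_geomRep hs⟩, ?_⟩
  rintro γ ⟨t, ht, rfl⟩
  exact (h.eq_neg_geomRep ht).symm

/-- The gate of the witnesses of `β` with respect to `x` is a witness with respect to every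
element whose inverse has the cone type of `x⁻¹`. -/
lemma IsGate.mem_witnesses_of_coneType_eq {x y z : W} (h : cs.IsGate (cs.witnesses x β) y)
    (hz : cs.coneType z⁻¹ = cs.coneType x⁻¹) : y ∈ cs.witnesses z β := by
  obtain ⟨s, hs⟩ := cs.exists_rightDescent_of_ne_one (ne_one_of_mem_witnesses h.1.1)
  have hβs := h.eq_neg_geomRep hs
  obtain ⟨hβx, hβy, hu⟩ := mem_witnesses_iff.mp h.1.1
  -- Being a witness is encoded by two conditions on the cone type alone: it contains `ys` but not
  -- `y`.
  have hys : y * cs.simple s ∈ cs.coneType x⁻¹ := by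
    rw [mem_coneType_inv_iff, Set.disjoint_left]
    intro γ hγx hγy
    obtain rfl := hu γ hγx ((mul_simple_rightWeakLE hs).inversionSet_subset hγy)
    refine not_mem_negRoots (simpleRoot_mem_posRoots (cs := cs) s) ?_
    have := hγy.2
    rwa [hβs, mul_inv_rev, inv_simple, geomRep_mul_apply, map_neg, geomRep_inv_geomRep, map_neg,
      geomRep_simple_simpleRoot_self, neg_neg] at this
  have hy : y ∉ cs.coneType x⁻¹ := by
    rw [mem_coneType_inv_iff]
    exact fun hd => Set.disjoint_left.mp hd hβx hβy
  rw [← hz, mem_coneType_inv_iff, Set.disjoint_left] at hys hy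
  have huz : ∀ γ ∈ cs.inversionSet z, γ ∈ cs.inversionSet y → γ = β := by
    intro γ hγz hγy
    by_contra hne
    exact hys hγz (mem_inversionSet_mul_simple hγy (hβs ▸ hne))
  push Not at hy
  obtain ⟨γ, hγz, hγy⟩ := hy
  obtain rfl := huz γ hγz hγy
  exact mem_witnesses_iff.mpr ⟨hγz, hβy, huz⟩

/-- The gate `y` of a set of witnesses is a prefix of every element whose inverse has the cone
type of `y⁻¹`. -/
lemma IsGate.rightWeakLE_of_coneType_eq {x y z : W} (h : cs.IsGate (cs.witnesses x β) y)
    (hz : cs.coneType z⁻¹ = cs.coneType y⁻¹) : cs.RightWeakLE y z := by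
  -- Exchange roles: the gate `x'` of the witnesses of `y` is also a witness for `z`. The gate `g`
  -- for `x'` is thus a prefix of both `y` and `z`; as a prefix of `y` inverting `β` it is a witness
  -- for `x`, so `y ≼ g ≼ z`.
  have hxy := mem_witnesses_comm.mp h.1.1
  obtain ⟨x', hx'⟩ := exists_isGate_witnesses ⟨x, hxy⟩
  have hyx' := mem_witnesses_comm.mp hx'.1.1
  have hzx' := mem_witnesses_comm.mp (hx'.mem_witnesses_of_coneType_eq hz)
  obtain ⟨g, hg⟩ := exists_isGate_witnesses ⟨y, hyx'⟩
  have hgx : g ∈ cs.witnesses x β :=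
    mem_witnesses_of_rightWeakLE h.1.1 (hg.2 y hyx') (mem_witnesses_iff.mp hg.1.1).2.1
  exact (h.2 g hgx).trans (hg.2 z hzx')

lemma IsGate.mem_tightGates {x y : W} (h : cs.IsGate (cs.witnesses x β) y) :
    y ∈ cs.tightGates := by
  refine ⟨⟨cs.coneType y⁻¹, ⟨_, rfl⟩, rfl, fun w hw hne => ?_⟩, ?_⟩
  · rw [length_inv, ← cs.length_inv w]
    refine (h.rightWeakLE_of_coneType_eq (z := w⁻¹) ?_).length_lt (by rintro rfl; simp at hne)
    rw [inv_inv]; exact hw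
  · rw [h.rightDescentRoots_eq, Set.ncard_singleton]

/-- The gate of the witnesses with respect to `x` is the gate of the witnesses with respect to
every element whose inverse has the cone type of `x⁻¹`. -/
lemma IsGate.of_coneType_eq {x y z : W} (h : cs.IsGate (cs.witnesses x β) y)
    (hz : cs.coneType z⁻¹ = cs.coneType x⁻¹) : cs.IsGate (cs.witnesses z β) y := by
  have hy := h.mem_witnesses_of_coneType_eq hz
  obtain ⟨g, hg⟩ := exists_isGate_witnesses ⟨y, hy⟩
  obtain rfl := (h.2 g (hg.mem_witnesses_of_coneType_eq hz.symm)).antisymm (hg.2 y hy)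
  exact hg

/-! ### Convexity -/

/-- Up to sign, `Φ(xv)` is the symmetric difference of `Φ(x)` and `xΦ(v)`. -/
lemma mem_inversionSet_mul_iff {x v : W} (hγ : γ ∈ cs.posRoots) :
    γ ∈ cs.inversionSet (x * v) ↔ (γ ∈ cs.inversionSet x ∧
        -cs.geomRep x⁻¹ γ ∉ cs.inversionSet v) ∨
      (γ ∉ cs.inversionSet x ∧ cs.geomRep x⁻¹ γ ∈ cs.inversionSet v) := by
  by_cases hx : γ ∈ cs.inversionSet x
  · simp only [hx, true_and, not_true, false_and, or_false]
    rw [not_mem_inversionSet_iff (neg_mem_posRoots_iff.mpr hx.2), map_neg, neg_mem_posRoots_iff,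
      ← geomRep_mul_apply, ← mul_inv_rev]
    exact and_iff_right hγ
  · simp only [hx, false_and, not_false_iff, true_and, false_or]
    rw [inversionSet, Set.mem_ofPred_eq, inversionSet, Set.mem_ofPred_eq, and_iff_right hγ,
      and_iff_right ((not_mem_inversionSet_iff hγ).mp hx), ← geomRep_mul_apply, ← mul_inv_rev]

/-- An element on a geodesic from `x` to `y` lies on the side of a wall that contains `x`
and `y`. -/
lemma mem_inversionSet_mul_iff_of_rightWeakLE {x y v : W} (hv : cs.RightWeakLE v (x⁻¹ * y))
    (hγ : γ ∈ cs.posRoots) (h : γ ∈ cs.inversionSet x ↔ γ ∈ cs.inversionSet y) :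
    γ ∈ cs.inversionSet (x * v) ↔ γ ∈ cs.inversionSet x := by
  have hy := mem_inversionSet_mul_iff (cs := cs) (x := x) (v := x⁻¹ * y) hγ
  rw [mul_inv_cancel_left, ← h] at hy
  rw [mem_inversionSet_mul_iff hγ]
  -- Since `x` and `y` lie on the same side, `x⁻¹y` does not invert `±x⁻¹γ`, hence neither does its
  -- prefix `v`.
  have h₁ : -cs.geomRep x⁻¹ γ ∈ _ → _ := fun h => hv.inversionSet_subset h
  have h₂ : cs.geomRep x⁻¹ γ ∈ _ → _ := fun h => hv.inversionSet_subset h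
  tauto

lemma IsReduced.take_rightWeakLE {ω : List B} (hω : cs.IsReduced ω) (j : ℕ) :
    cs.RightWeakLE (cs.wordProd (ω.take j)) (cs.wordProd ω) := by
  have h : cs.wordProd ω = cs.wordProd (ω.take j) * cs.wordProd (ω.drop j) := by
    rw [← wordProd_append, List.take_append_drop]
  have h₁ : (cs.wordProd (ω.take j))⁻¹ * cs.wordProd ω = cs.wordProd (ω.drop j) := by
    rw [h, inv_mul_cancel_left]
  rw [RightWeakLE, h₁, hω.eq, (hω.take j).eq, (hω.drop j).eq, ← List.length_append,
    List.take_append_drop]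

-- Each `x` only prescribes the side of the walls of `Φ(x)`: beyond that of `β`, not beyond the
-- others. Geodesics respect every such half-space.
variable (cs) in
lemma isConvex_coneTypeWitnesses (T : Set W) (β : B →₀ ℝ) :
    cs.IsConvex (cs.coneTypeWitnesses T β) := by
  intro a ha b hb ω hω hab j _ x hx
  have hle := hω.take_rightWeakLE j
  rw [hab] at hle
  have ha' := mem_witnesses_iff.mp (ha x hx)
  have hb' := mem_witnesses_iff.mp (hb x hx)
  refine mem_witnesses_iff.mpr ⟨ha'.1, ?_, fun γ hγx hγ => ?_⟩
  · exact (mem_inversionSet_mul_iff_of_rightWeakLE hle ha'.1.1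
      (iff_of_true ha'.2.1 hb'.2.1)).mpr ha'.2.1
  · by_contra hne
    have ha₁ : γ ∉ cs.inversionSet a := fun h => hne (ha'.2.2 γ hγx h)
    have hb₁ : γ ∉ cs.inversionSet b := fun h => hne (hb'.2.2 γ hγx h)
    exact ha₁ ((mem_inversionSet_mul_iff_of_rightWeakLE hle hγx.1 (iff_of_false ha₁ hb₁)).mp hγ)

end CoxeterSystem

theorem corollary1p5 {B W : Type*} [Finite B] [Group W] {M : CoxeterMatrix B}
    (cs : CoxeterSystem M W) (T : Set W) (hT : T ∈ cs.coneTypes)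
    (β : B →₀ ℝ) (hβ : β ∈ cs.boundaryRoots T) :
    (∃ y ∈ cs.tightGates,
      cs.IsUniqueShortest
        {z | ∀ x ∈ cs.coneTypePart T, cs.inversionSet x ∩ cs.inversionSet z = {β}} y ∧
      (∀ x ∈ cs.coneTypePart T, cs.IsGate (cs.witnesses x β) y) ∧
      cs.IsGate (cs.coneTypeWitnesses T β) y) ∧
    (cs.coneTypeWitnesses T β).Nonempty ∧
    (cs.coneTypeWitnesses T β = ⋂ x ∈ cs.coneTypePart T, cs.witnesses x β) ∧
    cs.IsConvex (cs.coneTypeWitnesses T β) ∧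
    cs.IsGated (cs.coneTypeWitnesses T β) := by
  obtain ⟨-, y₀, w, hw, hy₀⟩ := hβ
  obtain ⟨y, hy⟩ := CoxeterSystem.exists_isGate_witnesses (cs := cs) ⟨y₀, hy₀⟩
  have hall : ∀ x ∈ cs.coneTypePart T, cs.IsGate (cs.witnesses x β) y := fun x hx =>
    hy.of_coneType_eq (Eq.trans hx (Eq.symm hw))
  have hgate : cs.IsGate (cs.coneTypeWitnesses T β) y :=
    CoxeterSystem.isGate_iff.mpr ⟨fun x hx => (hall x hx).1.1, fun z hz => hy.2 z (hz w hw)⟩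
  refine ⟨⟨y, hy.mem_tightGates, hgate.1, hall, hgate⟩, ⟨y, hgate.1.1⟩, ?_,
    cs.isConvex_coneTypeWitnesses T β, ⟨y, hgate⟩⟩
  ext z
  simp only [Set.mem_iInter]
  rfl
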